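/- Let $m \ge 2$ and $n \ge 3$, let $G = \mathbb Z_m * \mathbb Z_n$, and let $s, t \in G$ be the images of generators of the factors $\mathbb Z_m$ and $\mathbb Z_n$. Let $\lambda$ be the left regular representation of $G$ on $\ell^2(G)$, and let $\mathrm C^*_{\mathrm{red}}(G) \subset \mathcal B(\ell^2(G))$ be the reduced group $\mathrm C^*$-algebra, in which $g \in G$ is identified with $\lambda(g)$. Take the model of $\mathrm BG$ whose 2-skeleton is the presentation complex of $\langle s, t \mid s^m, t^n\rangle$. Its cellular cochain complex with coefficients in $(\lambda, \ell^2(G))$ begins $$\ell^2(G) \xrightarrow{\,d_0\,} \ell^2(G)^{\oplus 2} \xrightarrow{\,d_1\,} \ell^2(G)^{\oplus 2},$$ where $d_0, d_1$ are the matrices over $\mathbb ZG$ of the cellular boundary maps of the universal cover (the entries of $d_1$ are the Fox derivatives of the relators), acting through $\lambda$. Let $\Delta_1 = d_1^* d_1 + d_0 d_0^*$, and let $p_1$ be the first higher Kazhdan projection, that is, the orthogonal projection of $\ell^2(G)^{\oplus 2}$ onto $\ker \Delta_1$. Then $p_1$ lies in $\mathrm M_2(\mathrm C^*_{\mathrm{red}}(G))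 \subset \mathcal B(\ell^2(G)^{\oplus 2})$, the elements $\frac1m\sum_{0\le i<m} s^i$ and $\frac1n\sum_{0\le j<n} t^j$ are projections in $\mathrm C^*_{\mathrm{red}}(G)$, and in $\mathrm K_0(\mathrm C^*_{\mathrm{red}}(G))$ $$[p_1] = [1] - \Bigl[\frac1m \sum_{0 \le i < m} s^i\Bigr] - \Bigl[\frac1n \sum_{0 \le j < n} t^j\Bigr].$$ -/

import Mathlib

/-! ## K₀ of a unital C*-algebra

Projections in matrix algebras over `A`, up to Murray-von Neumann equivalence, form a commutative
monoid under block-diagonal sum; `K₀(A)` is its Grothendieck group. -/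

section KTheory

/-- Projections of all finite sizes over `A`. -/
def MatProj (A : Type*) [Ring A] [StarRing A] : Type _ :=
  Σ k : ℕ, {p : Matrix (Fin k) (Fin k) A // IsStarProjection p}

/-- Murray-von Neumann equivalence `p = v* v`, `q = v v*` of two square matrices, of possibly
different sizes, with `v` rectangular. -/
def MvN {A ι κ : Type*} [Ring A] [StarRing A] [Fintype ι] [Fintype κ]
    (p : Matrix ι ι A) (q : Matrix κ κ A) : Prop :=
  ∃ v : Matrix κ ι A, v.conjTranspose * v = p ∧ v * v.conjTranspose = q

/-- The block-diagonal sum of two square matrices, as a matrix indexed by `Fin (k + l)`. -/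
def blockSum {A : Type*} [Ring A] {k l : ℕ}
    (p : Matrix (Fin k) (Fin k) A) (q : Matrix (Fin l) (Fin l) A) :
    Matrix (Fin (k + l)) (Fin (k + l)) A :=
  (Matrix.fromBlocks p 0 0 q).submatrix finSumFinEquiv.symm finSumFinEquiv.symm

variable {A : Type*} [Ring A] [StarRing A]

theorem MvN.refl {ι : Type*} [Fintype ι] {p : Matrix ι ι A} (hp : IsStarProjection p) :
    MvN p p := by
  have h1 : p * p = p := hp.isIdempotentElem
  have h2 : p.conjTranspose = p := hp.isSelfAdjoint
  exact ⟨p, by rw [h2, h1], by rw [h2, h1]⟩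

theorem MvN.symm {ι κ : Type*} [Fintype ι] [Fintype κ] {p : Matrix ι ι A} {q : Matrix κ κ A}
    (h : MvN p q) : MvN q p := by
  obtain ⟨v, h1, h2⟩ := h
  exact ⟨v.conjTranspose, by simpa using h2, by simpa using h1⟩

theorem MvN.trans {ι κ τ : Type*} [Fintype ι] [Fintype κ] [Fintype τ]
    {p : Matrix ι ι A} {q : Matrix κ κ A} {r : Matrix τ τ A}
    (hp : IsStarProjection p) (hr : IsStarProjection r)
    (h : MvN p q) (h' : MvN q r) : MvN p r := by
  obtain ⟨v, h1, h2⟩ := h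
  obtain ⟨w, h3, h4⟩ := h'
  have hpp : p * p = p := hp.isIdempotentElem
  have hrr : r * r = r := hr.isIdempotentElem
  refine ⟨w * v, ?_, ?_⟩
  · calc (w * v).conjTranspose * (w * v)
        = v.conjTranspose * (w.conjTranspose * w) * v := by
          simp only [Matrix.conjTranspose_mul, Matrix.mul_assoc]
      _ = (v.conjTranspose * v) * (v.conjTranspose * v) := by
          rw [h3, ← h2]; simp only [Matrix.mul_assoc]
      _ = p := by rw [h1, hpp]
  · calc (w * v) * (w * v).conjTranspose
        = w * (v * v.conjTranspose) * w.conjTranspose := by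
          simp only [Matrix.conjTranspose_mul, Matrix.mul_assoc]
      _ = (w * w.conjTranspose) * (w * w.conjTranspose) := by
          rw [h2, ← h3]; simp only [Matrix.mul_assoc]
      _ = r := by rw [h4, hrr]

/-- Relabelling the index set of a projection does not change its Murray-von Neumann class. -/
theorem MvN.reindex {ι κ : Type*} [Fintype ι] [Fintype κ]
    {p : Matrix ι ι A} (hp : IsStarProjection p) (e : κ ≃ ι) :
    MvN p (p.submatrix e e) := by
  have h1 : p * p = p := hp.isIdempotentElem
  have h2 : p.conjTranspose = p := hp.isSelfAdjoint
  refine ⟨p.submatrix e id, ?_, ?_⟩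
  · rw [Matrix.conjTranspose_submatrix, h2, Matrix.submatrix_mul_equiv, h1, Matrix.submatrix_id_id]
  · rw [Matrix.conjTranspose_submatrix, h2,
      ← Matrix.submatrix_mul p p e id e Function.bijective_id, h1]

theorem isStarProjection_fromBlocks {ι κ : Type*} [Fintype ι] [Fintype κ]
    {p : Matrix ι ι A} {q : Matrix κ κ A} (hp : IsStarProjection p) (hq : IsStarProjection q) :
    IsStarProjection (Matrix.fromBlocks p 0 0 q) := by
  have h1 : p * p = p := hp.isIdempotentElem
  have h2 : p.conjTranspose = p := hp.isSelfAdjoint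
  have h3 : q * q = q := hq.isIdempotentElem
  have h4 : q.conjTranspose = q := hq.isSelfAdjoint
  constructor
  · simp [IsIdempotentElem, Matrix.fromBlocks_multiply, h1, h3]
  · change (Matrix.fromBlocks p 0 0 q).conjTranspose = _
    simp [Matrix.fromBlocks_conjTranspose, h2, h4]

theorem isStarProjection_submatrix {ι κ : Type*} [Fintype ι] [Fintype κ]
    {p : Matrix ι ι A} (hp : IsStarProjection p) (e : κ ≃ ι) :
    IsStarProjection (p.submatrix e e) := by
  have h1 : p * p = p := hp.isIdempotentElem
  have h2 : p.conjTranspose = p := hp.isSelfAdjoint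
  constructor
  · rw [IsIdempotentElem, Matrix.submatrix_mul_equiv, h1]
  · change (p.submatrix e e).conjTranspose = _
    rw [Matrix.conjTranspose_submatrix, h2]

theorem isStarProjection_blockSum {k l : ℕ}
    {p : Matrix (Fin k) (Fin k) A} {q : Matrix (Fin l) (Fin l) A}
    (hp : IsStarProjection p) (hq : IsStarProjection q) : IsStarProjection (blockSum p q) :=
  isStarProjection_submatrix (isStarProjection_fromBlocks hp hq) finSumFinEquiv.symm

theorem MvN.fromBlocks {ι κ ι' κ' : Type*} [Fintype ι] [Fintype κ] [Fintype ι'] [Fintype κ']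
    {p : Matrix ι ι A} {q : Matrix κ κ A} {p' : Matrix ι' ι' A} {q' : Matrix κ' κ' A}
    (h : MvN p p') (h' : MvN q q') :
    MvN (Matrix.fromBlocks p 0 0 q) (Matrix.fromBlocks p' 0 0 q') := by
  obtain ⟨v, h1, h2⟩ := h
  obtain ⟨w, h3, h4⟩ := h'
  refine ⟨Matrix.fromBlocks v 0 0 w, ?_, ?_⟩ <;>
    simp [Matrix.fromBlocks_conjTranspose, Matrix.fromBlocks_multiply, h1, h2, h3, h4]

theorem MvN.toBlockSum {k l : ℕ}
    {p : Matrix (Fin k) (Fin k) A} {q : Matrix (Fin l) (Fin l) A}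
    (hp : IsStarProjection p) (hq : IsStarProjection q) :
    MvN (Matrix.fromBlocks p 0 0 q) (blockSum p q) :=
  MvN.reindex (isStarProjection_fromBlocks hp hq) finSumFinEquiv.symm

theorem MvN.blockSum {k l k' l' : ℕ}
    {p : Matrix (Fin k) (Fin k) A} {q : Matrix (Fin l) (Fin l) A}
    {p' : Matrix (Fin k') (Fin k') A} {q' : Matrix (Fin l') (Fin l') A}
    (hp : IsStarProjection p) (hq : IsStarProjection q)
    (hp' : IsStarProjection p') (hq' : IsStarProjection q')
    (h : MvN p p') (h' : MvN q q') : MvN (blockSum p q) (blockSum p' q') :=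
  ((MvN.toBlockSum hp hq).symm.trans (isStarProjection_blockSum hp hq)
    (isStarProjection_fromBlocks hp' hq') (MvN.fromBlocks h h')).trans
    (isStarProjection_blockSum hp hq) (isStarProjection_blockSum hp' hq')
    (MvN.toBlockSum hp' hq')

theorem MvN.blockSum_comm {k l : ℕ}
    {p : Matrix (Fin k) (Fin k) A} {q : Matrix (Fin l) (Fin l) A}
    (hp : IsStarProjection p) (hq : IsStarProjection q) :
    MvN (_root_.blockSum p q) (_root_.blockSum q p) := by
  have h := MvN.reindex (isStarProjection_fromBlocks hp hq) (Equiv.sumComm (Fin l) (Fin k))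
  have h' : (Matrix.fromBlocks p 0 0 q).submatrix (Equiv.sumComm (Fin l) (Fin k))
      (Equiv.sumComm (Fin l) (Fin k)) = Matrix.fromBlocks q 0 0 p := by
    ext (i | i) (j | j) <;> simp
  rw [h'] at h
  exact ((MvN.toBlockSum hp hq).symm.trans (isStarProjection_blockSum hp hq)
    (isStarProjection_fromBlocks hq hp) h).trans (isStarProjection_blockSum hp hq)
    (isStarProjection_blockSum hq hp) (MvN.toBlockSum hq hp)

theorem MvN.blockSum_assoc {k l r : ℕ} {p : Matrix (Fin k) (Fin k) A}
    {q : Matrix (Fin l) (Fin l) A} {s : Matrix (Fin r) (Fin r) A}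
    (hp : IsStarProjection p) (hq : IsStarProjection q) (hs : IsStarProjection s) :
    MvN (_root_.blockSum (_root_.blockSum p q) s) (_root_.blockSum p (_root_.blockSum q s)) := by
  have hL := isStarProjection_blockSum (isStarProjection_blockSum hp hq) hs
  have hR := isStarProjection_blockSum hp (isStarProjection_blockSum hq hs)
  let e : Fin (k + (l + r)) ≃ Fin (k + l + r) :=
    finSumFinEquiv.symm.trans (((Equiv.refl _).sumCongr finSumFinEquiv.symm).trans
      ((Equiv.sumAssoc _ _ _).symm.trans ((finSumFinEquiv.sumCongr (Equiv.refl _)).trans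
        finSumFinEquiv)))
  have h := MvN.reindex hL e
  have h' : (_root_.blockSum (_root_.blockSum p q) s).submatrix e e
      = _root_.blockSum p (_root_.blockSum q s) := by
    ext i j
    obtain ⟨i, rfl⟩ := finSumFinEquiv.surjective i
    obtain ⟨j, rfl⟩ := finSumFinEquiv.surjective j
    obtain i | i := i
    · obtain j | j := j
      · simp [e, _root_.blockSum]
      · obtain ⟨j, rfl⟩ := finSumFinEquiv.surjective j
        obtain j | j := j <;> simp [e, _root_.blockSum]
    · obtain ⟨i, rfl⟩ := finSumFinEquiv.surjective i
      obtain j | j := j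
      · obtain i | i := i <;> simp [e, _root_.blockSum]
      · obtain ⟨j, rfl⟩ := finSumFinEquiv.surjective j
        obtain i | i := i <;> obtain j | j := j <;> simp [e, _root_.blockSum]
  rwa [h'] at h

theorem MvN.zero_blockSum {k : ℕ} {p : Matrix (Fin k) (Fin k) A} (hp : IsStarProjection p) :
    MvN (_root_.blockSum (0 : Matrix (Fin 0) (Fin 0) A) p) p := by
  have h0 : IsStarProjection (0 : Matrix (Fin 0) (Fin 0) A) := IsStarProjection.zero _
  have h := MvN.reindex (isStarProjection_fromBlocks h0 hp) (Equiv.emptySum (Fin 0) (Fin k)).symm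
  have h' : (Matrix.fromBlocks (0 : Matrix (Fin 0) (Fin 0) A) 0 0 p).submatrix
      (Equiv.emptySum (Fin 0) (Fin k)).symm (Equiv.emptySum (Fin 0) (Fin k)).symm = p := by
    ext i j
    simp
  rw [h'] at h
  exact (MvN.toBlockSum h0 hp).symm.trans (isStarProjection_blockSum h0 hp) hp h

variable (A) in
/-- Murray-von Neumann equivalence as a setoid on projections of all sizes. -/
def MatProj.setoid : Setoid (MatProj A) where
  r p q := MvN p.2.1 q.2.1
  iseqv :=
    { refl := fun p => MvN.refl p.2.2
      symm := fun h => MvN.symm h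
      trans := fun {p _ r} h h' => MvN.trans p.2.2 r.2.2 h h' }

variable (A) in
/-- Murray-von Neumann classes of projections in matrices over `A`. -/
def VMonoid : Type _ := Quotient (MatProj.setoid A)

/-- The Murray-von Neumann class of a projection. -/
def VMonoid.mk {k : ℕ} (p : Matrix (Fin k) (Fin k) A) (hp : IsStarProjection p) : VMonoid A :=
  Quotient.mk (MatProj.setoid A) ⟨k, p, hp⟩

instance VMonoid.instZero : Zero (VMonoid A) where
  zero := VMonoid.mk (0 : Matrix (Fin 0) (Fin 0) A) (IsStarProjection.zero _)

instance VMonoid.instAdd : Add (VMonoid A) where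
  add := Quotient.map₂
    (fun p q => (⟨p.1 + q.1, blockSum p.2.1 q.2.1, isStarProjection_blockSum p.2.2 q.2.2⟩ :
      MatProj A))
    (fun p p' h q q' h' => MvN.blockSum p.2.2 q.2.2 p'.2.2 q'.2.2 h h')

instance VMonoid.instAddCommMonoid : AddCommMonoid (VMonoid A) where
  add_assoc := by
    rintro ⟨p⟩ ⟨q⟩ ⟨r⟩
    exact Quotient.sound (MvN.blockSum_assoc p.2.2 q.2.2 r.2.2)
  add_comm := by
    rintro ⟨p⟩ ⟨q⟩
    exact Quotient.sound (MvN.blockSum_comm p.2.2 q.2.2)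
  zero_add := by
    rintro ⟨p⟩
    exact Quotient.sound (MvN.zero_blockSum p.2.2)
  add_zero := by
    rintro ⟨p⟩
    exact Quotient.sound ((MvN.blockSum_comm p.2.2 (IsStarProjection.zero _)).trans
      (isStarProjection_blockSum p.2.2 (IsStarProjection.zero _)) p.2.2
      (MvN.zero_blockSum p.2.2))
  nsmul := nsmulRec

variable (A) in
/-- `K₀(A)`: the Grothendieck group of the monoid of Murray-von Neumann classes of projections in
matrices over the unital C*-algebra `A`. -/
abbrev KZero : Type _ := Algebra.GrothendieckAddGroup (VMonoid A)

/-- The class `[p] ∈ K₀(A)` of a projection `p ∈ M_k(A)`. -/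
def KZero.cls {k : ℕ} (p : Matrix (Fin k) (Fin k) A) (hp : IsStarProjection p) : KZero A :=
  Algebra.GrothendieckAddGroup.of (VMonoid.mk p hp)

end KTheory

/-! ## The left regular representation and the reduced group C*-algebra -/

noncomputable section Regular

/-- The Hilbert space `ℓ²(G)`. -/
abbrev EllTwo (G : Type*) : Type _ := lp (fun _ : G => ℂ) 2

theorem memℓp_perm {G : Type*} (e : Equiv.Perm G) {f : G → ℂ}
    (hf : Memℓp (E := fun _ : G => ℂ) f 2) : Memℓp (E := fun _ : G => ℂ) (fun h => f (e h)) 2 := by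
  rw [memℓp_gen_iff (by norm_num)] at hf ⊢
  exact e.summable_iff.mpr hf

/-- The unitary of `ℓ²(G)` that permutes coordinates, `(e f)(h) = f (e⁻¹ h)`. -/
def ellTwoPerm {G : Type*} (e : Equiv.Perm G) : EllTwo G ≃ₗᵢ[ℂ] EllTwo G where
  toFun f := ⟨fun h => f (e.symm h), memℓp_perm e.symm (lp.memℓp f)⟩
  invFun f := ⟨fun h => f (e h), memℓp_perm e (lp.memℓp f)⟩
  map_add' f g := by ext h; rfl
  map_smul' c f := by ext h; rfl
  left_inv f := by ext h; simp
  right_inv f := by ext h; simp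
  norm_map' f := by
    rw [lp.norm_eq_tsum_rpow (by norm_num), lp.norm_eq_tsum_rpow (by norm_num)]
    congr 1
    exact e.symm.tsum_eq (fun h => ‖f h‖ ^ (2 : ENNReal).toReal)

/-- The left regular representation `λ` of `G` on `ℓ²(G)`: `(λ(g) f)(h) = f (g⁻¹ h)`. -/
def leftRegularRep (G : Type*) [Group G] : G →* (EllTwo G ≃ₗᵢ[ℂ] EllTwo G) where
  toFun g := ellTwoPerm (Equiv.mulLeft g)
  map_one' := by ext f h; simp [ellTwoPerm]
  map_mul' a b := by ext f h; simp [ellTwoPerm, mul_assoc]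

/-- The operators of a unitary representation, as a homomorphism into the bounded operators. -/
def repOp {G H : Type*} [Group G] [NormedAddCommGroup H] [InnerProductSpace ℂ H]
    (π : G →* (H ≃ₗᵢ[ℂ] H)) : G →* (H →L[ℂ] H) where
  toFun g := ((π g).toContinuousLinearEquiv : H →L[ℂ] H)
  map_one' := by ext x; simp
  map_mul' a b := by ext x; simp

/-- The reduced group C*-algebra: the norm closure in `B(ℓ²(G))` of the *-algebra generated by
the operators `λ(g)`. -/
def redCStar (G : Type*) [Group G] : StarSubalgebra ℂ (EllTwo G →L[ℂ] EllTwo G) :=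
  (StarAlgebra.adjoin ℂ (Set.range (repOp (leftRegularRep G)))).topologicalClosure

/-- A group element, regarded as an element of the reduced group C*-algebra. -/
def redCStar.of {G : Type*} [Group G] (g : G) : redCStar G :=
  ⟨repOp (leftRegularRep G) g,
    StarSubalgebra.le_topologicalClosure _ (StarAlgebra.subset_adjoin ℂ _ ⟨g, rfl⟩)⟩

/-- The average `(1/m) ∑_{0 ≤ i < m} g^i` in the reduced group C*-algebra. -/
def redCStar.avg {G : Type*} [Group G] (m : ℕ) (g : G) : redCStar G :=
  (m : ℂ)⁻¹ • ∑ i ∈ Finset.range m, redCStar.of (g ^ i)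

end Regular

/-! ## Higher Kazhdan projections -/

noncomputable section Kazhdan

variable {G H : Type*} [Group G] [NormedAddCommGroup H] [InnerProductSpace ℂ H]

/-- A matrix `(T i j)` of bounded operators on `H`, as an operator between finite direct sums of
copies of `H`: `(T x) i = ∑ j, T i j (x j)`. -/
def matrixOp {ι κ : Type*} [Fintype ι] [Fintype κ] (T : Matrix κ ι (H →L[ℂ] H)) :
    PiLp 2 (fun _ : ι => H) →L[ℂ] PiLp 2 (fun _ : κ => H) :=
  ((PiLp.continuousLinearEquiv 2 ℂ (fun _ : κ => H)).symm :
      (κ → H) →L[ℂ] PiLp 2 (fun _ : κ => H)).comp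
    (ContinuousLinearMap.pi fun i => ∑ j, (T i j).comp (PiLp.proj 2 (fun _ : ι => H) j))

/-- The extension of a unitary representation to the integral group ring. -/
def groupRingRep (π : G →* (H ≃ₗᵢ[ℂ] H)) : MonoidAlgebra ℤ G →ₐ[ℤ] (H →L[ℂ] H) :=
  MonoidAlgebra.lift ℤ (H →L[ℂ] H) G (repOp π)

/-- The coboundary `π(D) : H^ι → H^κ` given by a matrix `D` over the integral group ring. If `D`
is the matrix of a boundary map of based free left `ℤG`-modules, `e_i ↦ ∑ j, D i j • e_j`, this is
the map that it induces on `Hom_{ℤG}(-, H)`. -/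
def coboundary (π : G →* (H ≃ₗᵢ[ℂ] H)) {ι κ : Type*} [Fintype ι] [Fintype κ]
    (D : Matrix κ ι (MonoidAlgebra ℤ G)) :
    PiLp 2 (fun _ : ι => H) →L[ℂ] PiLp 2 (fun _ : κ => H) :=
  matrixOp (D.map (groupRingRep π))

variable [CompleteSpace H]

/-- The combinatorial Laplacian `d_n^* d_n + d_{n-1} d_{n-1}^*` on `n`-cochains, where `d_{n-1}`
and `d_n` are given by the matrices `D₀` and `D₁` over the integral group ring. -/
def laplacian (π : G →* (H ≃ₗᵢ[ℂ] H)) {α ι κ : Type*} [Fintype α] [Fintype ι] [Fintype κ]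
    (D₀ : Matrix ι α (MonoidAlgebra ℤ G)) (D₁ : Matrix κ ι (MonoidAlgebra ℤ G)) :
    PiLp 2 (fun _ : ι => H) →L[ℂ] PiLp 2 (fun _ : ι => H) :=
  (ContinuousLinearMap.adjoint (coboundary π D₁)).comp (coboundary π D₁) +
    (coboundary π D₀).comp (ContinuousLinearMap.adjoint (coboundary π D₀))

/-- The higher Kazhdan projection: the orthogonal projection onto the kernel of the Laplacian,
that is, onto the harmonic cochains. -/
def kazhdanProjection (π : G →* (H ≃ₗᵢ[ℂ] H)) {α ι κ : Type*}
    [Fintype α] [Fintype ι] [Fintype κ]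
    (D₀ : Matrix ι α (MonoidAlgebra ℤ G)) (D₁ : Matrix κ ι (MonoidAlgebra ℤ G)) :
    PiLp 2 (fun _ : ι => H) →L[ℂ] PiLp 2 (fun _ : ι => H) :=
  haveI : CompleteSpace (laplacian π D₀ D₁).ker :=
    (laplacian π D₀ D₁).isClosed_ker.completeSpace_coe
  (laplacian π D₀ D₁).ker.starProjection

end Kazhdan

/-! ## The presentation complex -/

noncomputable section Presentation

/-- A presentation of the group `G` with generators indexed by `ι` and relators indexed by `ρ`. -/
structure GroupPres (G : Type*) [Group G] (ι ρ : Type*) where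
  /-- the generators -/
  gen : ι → G
  /-- the relators -/
  rel : ρ → FreeGroup ι
  /-- the generators generate `G` -/
  surj : Function.Surjective (FreeGroup.lift gen)
  /-- all relations follow from the relators -/
  ker_eq : (FreeGroup.lift gen).ker = Subgroup.normalClosure (Set.range rel)

namespace GroupPres

variable {G : Type*} [Group G] {ι ρ : Type*} [DecidableEq ι]

/-- The Fox derivative `∂w/∂x_j` of a word `w` in the letters `x_i^{±1}`, evaluated in `ℤG` through
`x_i ↦ x i`: the 1-chain (coefficient of the edge `x_j`) of the path in the Cayley complex that
starts at `1` and reads `w`. It obeys `∂(uv) = ∂u + u ∂v`, `∂x_i = δ_ij`, `∂x_i⁻¹ = -x_i⁻¹ δ_ij`. -/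
def foxWord (x : ι → G) (j : ι) : List (ι × Bool) → MonoidAlgebra ℤ G
  | [] => 0
  | (i, true) :: w =>
      (if i = j then 1 else 0) + MonoidAlgebra.of ℤ G (x i) * foxWord x j w
  | (i, false) :: w =>
      MonoidAlgebra.of ℤ G (x i)⁻¹ * (foxWord x j w - if i = j then 1 else 0)

/-- The boundary `∂₁` of the cellular chain complex of the universal cover of the presentation
complex (one vertex, an edge for each generator, a 2-cell for each relator), `e_i ↦ x_i - 1`. -/
def boundaryOne (P : GroupPres G ι ρ) : Matrix ι (Fin 1) (MonoidAlgebra ℤ G) :=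
  Matrix.of fun i _ => MonoidAlgebra.of ℤ G (P.gen i) - 1

/-- The boundary `∂₂` of the same complex, `e_r ↦ ∑ j, (∂r/∂x_j) e_j`. -/
def boundaryTwo (P : GroupPres G ι ρ) : Matrix ρ ι (MonoidAlgebra ℤ G) :=
  Matrix.of fun r j => foxWord P.gen j (P.rel r).toWord

/-- The first higher Kazhdan projection of a unitary representation `π` of `G`, for the model of
`BG` whose 2-skeleton is the presentation complex of the finite presentation `P`. -/
def kazhdanOne {H : Type*} [NormedAddCommGroup H] [InnerProductSpace ℂ H] [CompleteSpace H]
    [Fintype ι] [Fintype ρ] (P : GroupPres G ι ρ) (π : G →* (H ≃ₗᵢ[ℂ] H)) :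
    PiLp 2 (fun _ : ι => H) →L[ℂ] PiLp 2 (fun _ : ι => H) :=
  kazhdanProjection π P.boundaryOne P.boundaryTwo

end GroupPres

/-- The free product `ℤ_m * ℤ_n` (written multiplicatively). -/
abbrev CyclicFreeProduct (m n : ℕ) : Type :=
  Monoid.Coprod (Multiplicative (ZMod m)) (Multiplicative (ZMod n))

open Monoid.Coprod in
/-- The presentation `⟨s, t | s^m, t^n⟩` of `ℤ_m * ℤ_n`, for generators `a` of `ℤ_m` and `b` of
`ℤ_n`. -/
def cyclicFreeProductPres (m n : ℕ)
    (a : Multiplicative (ZMod m)) (ha : ∀ x, x ∈ Subgroup.zpowers a)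
    (b : Multiplicative (ZMod n)) (hb : ∀ x, x ∈ Subgroup.zpowers b) :
    GroupPres (CyclicFreeProduct m n) (Fin 2) (Fin 2) where
  gen := ![inl a, inr b]
  rel := ![FreeGroup.of 0 ^ m, FreeGroup.of 1 ^ n]
  surj := by
    intro g
    induction g using Monoid.Coprod.induction_on with
    | inl x =>
      obtain ⟨k, rfl⟩ := Subgroup.mem_zpowers_iff.mp (ha x)
      exact ⟨FreeGroup.of 0 ^ k, by simp⟩
    | inr x =>
      obtain ⟨k, rfl⟩ := Subgroup.mem_zpowers_iff.mp (hb x)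
      exact ⟨FreeGroup.of 1 ^ k, by simp⟩
    | mul x y hx hy =>
      obtain ⟨u, rfl⟩ := hx
      obtain ⟨v, rfl⟩ := hy
      exact ⟨u * v, by simp⟩
  ker_eq := by
    have oa : orderOf a = m := by
      rw [orderOf_eq_card_of_forall_mem_zpowers ha, Nat.card_congr Multiplicative.toAdd,
        Nat.card_zmod]
    have ob : orderOf b = n := by
      rw [orderOf_eq_card_of_forall_mem_zpowers hb, Nat.card_congr Multiplicative.toAdd,
        Nat.card_zmod]
    set R : Set (FreeGroup (Fin 2)) := Set.range ![FreeGroup.of 0 ^ m, FreeGroup.of 1 ^ n] with hR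
    set q := QuotientGroup.mk' (Subgroup.normalClosure R) with hq
    apply le_antisymm
    · have h0 : q (FreeGroup.of 0) ^ m = 1 := by
        rw [← map_pow, hq, QuotientGroup.mk'_apply, QuotientGroup.eq_one_iff]
        exact Subgroup.subset_normalClosure ⟨0, rfl⟩
      have h1 : q (FreeGroup.of 1) ^ n = 1 := by
        rw [← map_pow, hq, QuotientGroup.mk'_apply, QuotientGroup.eq_one_iff]
        exact Subgroup.subset_normalClosure ⟨1, rfl⟩
      have d0 : orderOf (q (FreeGroup.of 0)) ∣ orderOf a := by
        rw [oa]; exact orderOf_dvd_of_pow_eq_one h0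
      have d1 : orderOf (q (FreeGroup.of 1)) ∣ orderOf b := by
        rw [ob]; exact orderOf_dvd_of_pow_eq_one h1
      let ψ := Monoid.Coprod.lift (monoidHomOfForallMemZpowers ha d0)
        (monoidHomOfForallMemZpowers hb d1)
      have hψ : ψ.comp (FreeGroup.lift ![inl a, inr b]) = q := by
        apply FreeGroup.ext_hom
        intro i
        fin_cases i
        · simp [ψ, monoidHomOfForallMemZpowers_apply_gen]
        · simp [ψ, monoidHomOfForallMemZpowers_apply_gen]
      intro w hw
      have : q w = 1 := by
        rw [← hψ, MonoidHom.comp_apply, MonoidHom.mem_ker.mp hw, map_one]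
      rwa [hq, QuotientGroup.mk'_apply, QuotientGroup.eq_one_iff] at this
    · apply Subgroup.normalClosure_le_normal
      rintro _ ⟨i, rfl⟩
      fin_cases i
      · have h : a ^ m = 1 := orderOf_dvd_iff_pow_eq_one.mp (dvd_of_eq oa)
        have h' := congrArg (inl : _ →* CyclicFreeProduct m n) h
        rw [map_pow, map_one] at h'
        simp [MonoidHom.mem_ker, h']
      · have h : b ^ n = 1 := orderOf_dvd_iff_pow_eq_one.mp (dvd_of_eq ob)
        have h' := congrArg (inr : _ →* CyclicFreeProduct m n) h
        rw [map_pow, map_one] at h'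
        simp [MonoidHom.mem_ker, h']

end Presentation

/-!
Write `p` and `q` for the averages over `⟨s⟩` and `⟨t⟩`. The relators are powers of the generators,
so their Fox Jacobian is diagonal and `d₁ = diag (m p, n q)`, while `d₀` is the column
`D = (s - 1, t - 1)`. Hence `ker d₁ = ker p ⊕ ker q` is the range of `1 - E` for `E = diag (p, q)`;
the range of `D` is orthogonal to that of `E`, and the harmonic space is what remains of
`ℓ²(G)²` after removing both.

The analytic input is that `D` is bounded below on `ℓ²(G)`. It comes from a paradoxical subset of
`G`, the words that begin with a power of `t` (`exists_paradoxical`): it is disjoint from a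
translate of itself and its complement has three disjoint translates, so that no unit vector is
almost fixed by both `s` and `t` (`norm_le_of_paradoxical`). This is where `2 ≤ m` and `3 ≤ n` enter.
Therefore `D* D` is invertible in the reduced C*-algebra and has an inverse square root `β` there;
`V = D β` is an isometry with the same range as `D`, and `p₁ = 1 - E - V V*` has entries in the
reduced C*-algebra. It is identified with the Kazhdan projection algebraically: the Laplacian
kills it, and has a left inverse modulo it (`laplacian_mul_complement`, `inverse_mul_laplacian`,
`kazhdanProjection_eq_matrixOp`).

In K-theory `V` is an equivalence between `1` and `V V*`, and block sums of orthogonal projections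
have the class of the sum, so `[p₁] = 2 [1] - ([p] + [q]) - [1]` (`KZero.cls_one_sub`).
-/

/-! ### Orthogonal sums in `K₀` and the matrix Laplacian -/

section Projections

variable {A : Type*} [Ring A] [StarRing A]

/-- Two orthogonal projections: the row `(p, q)` implements an equivalence of the block sum of `p`
and `q` with `p + q`. -/
theorem MvN.fromBlocks_add {κ : Type*} [Fintype κ] {p q : Matrix κ κ A}
    (hp : IsStarProjection p) (hq : IsStarProjection q) (hpq : p * q = 0) :
    MvN (Matrix.fromBlocks p 0 0 q) (p + q) := by
  have h1 : p * p = p := hp.isIdempotentElem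
  have h2 : p.conjTranspose = p := hp.isSelfAdjoint
  have h3 : q * q = q := hq.isIdempotentElem
  have h4 : q.conjTranspose = q := hq.isSelfAdjoint
  have h5 : q * p = 0 := by
    simpa [h2, h4] using congrArg Matrix.conjTranspose hpq
  refine ⟨Matrix.fromCols p q, ?_, ?_⟩
  · rw [Matrix.conjTranspose_fromCols_eq_fromRows_conjTranspose, Matrix.fromRows_mul_fromCols,
      h2, h4, h1, h3, hpq, h5]
  · rw [Matrix.conjTranspose_fromCols_eq_fromRows_conjTranspose, Matrix.fromCols_mul_fromRows,
      h2, h4, h1, h3]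

theorem KZero.cls_eq_of_mvN {k l : ℕ} {p : Matrix (Fin k) (Fin k) A} {q : Matrix (Fin l) (Fin l) A}
    (hp : IsStarProjection p) (hq : IsStarProjection q) (h : MvN p q) :
    KZero.cls p hp = KZero.cls q hq :=
  congrArg Algebra.GrothendieckAddGroup.of (Quotient.sound h)

theorem KZero.cls_blockSum {k l : ℕ} {p : Matrix (Fin k) (Fin k) A} {q : Matrix (Fin l) (Fin l) A}
    (hp : IsStarProjection p) (hq : IsStarProjection q) :
    KZero.cls (blockSum p q) (isStarProjection_blockSum hp hq)
      = KZero.cls p hp + KZero.cls q hq := by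
  unfold KZero.cls
  rw [← map_add]
  rfl

theorem KZero.cls_add {k : ℕ} {p q : Matrix (Fin k) (Fin k) A}
    (hp : IsStarProjection p) (hq : IsStarProjection q) (hpq : p * q = 0)
    (hs : IsStarProjection (p + q)) :
    KZero.cls (p + q) hs = KZero.cls p hp + KZero.cls q hq := by
  rw [← KZero.cls_blockSum hp hq]
  exact KZero.cls_eq_of_mvN _ _ ((MvN.fromBlocks_add hp hq hpq).symm.trans hs
    (isStarProjection_blockSum hp hq) (MvN.toBlockSum hp hq))

theorem KZero.cls_one_two :
    KZero.cls (1 : Matrix (Fin 2) (Fin 2) A) (IsStarProjection.one _)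
      = KZero.cls (1 : Matrix (Fin 1) (Fin 1) A) (IsStarProjection.one _)
        + KZero.cls (1 : Matrix (Fin 1) (Fin 1) A) (IsStarProjection.one _) := by
  rw [← KZero.cls_blockSum]
  congr 1
  simp [blockSum]

section Complement

variable {κ ι : Type*} [Fintype κ] [Fintype ι] [DecidableEq ι]
  {E : Matrix κ κ A} {V : Matrix κ ι A}

theorem isStarProjection_mul_conjTranspose (hV : V.conjTranspose * V = 1) :
    IsStarProjection (V * V.conjTranspose) := by
  constructor
  · rw [IsIdempotentElem, Matrix.mul_assoc, ← Matrix.mul_assoc V.conjTranspose, hV, Matrix.one_mul]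
  · change (V * V.conjTranspose).conjTranspose = _
    simp

theorem isStarProjection_add_range (hE : IsStarProjection E) (hV : V.conjTranspose * V = 1)
    (hEV : E * V = 0) : IsStarProjection (E + V * V.conjTranspose) :=
  hE.add (isStarProjection_mul_conjTranspose hV) (by rw [← Matrix.mul_assoc, hEV, Matrix.zero_mul])

end Complement

/-- If the columns of `V` form an isometry whose range is orthogonal to `E`, the complement of
`E ⊕ range V` has class `[1] - [E] - [1]`, since `V` identifies its range projection with `1`. -/
theorem KZero.cls_one_sub {k l : ℕ} {E : Matrix (Fin k) (Fin k) A} {V : Matrix (Fin k) (Fin l) A}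
    (hE : IsStarProjection E) (hV : V.conjTranspose * V = 1) (hEV : E * V = 0)
    (hP : IsStarProjection (1 - (E + V * V.conjTranspose))) :
    KZero.cls (1 - (E + V * V.conjTranspose)) hP
      = KZero.cls (1 : Matrix (Fin k) (Fin k) A) (IsStarProjection.one _) - KZero.cls E hE
        - KZero.cls (1 : Matrix (Fin l) (Fin l) A) (IsStarProjection.one _) := by
  have hR := isStarProjection_mul_conjTranspose hV
  have hS := isStarProjection_add_range hE hV hEV
  have h1 : KZero.cls (1 : Matrix (Fin l) (Fin l) A) (IsStarProjection.one _)
      = KZero.cls (V * V.conjTranspose) hR := KZero.cls_eq_of_mvN _ _ ⟨V, hV, rfl⟩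
  have h2 := KZero.cls_add hE hR (by rw [← Matrix.mul_assoc, hEV, Matrix.zero_mul]) hS
  have h3 := KZero.cls_add hP hS
    (by rw [sub_mul, one_mul, hS.isIdempotentElem.eq, sub_self])
    (by rw [sub_add_cancel]; exact IsStarProjection.one _)
  have h4 : KZero.cls (1 - (E + V * V.conjTranspose) + (E + V * V.conjTranspose))
      (by rw [sub_add_cancel]; exact IsStarProjection.one _)
      = KZero.cls (1 : Matrix (Fin k) (Fin k) A) (IsStarProjection.one _) := by
    congr 1
    exact sub_add_cancel _ _
  rw [← h4, h3, h2, h1]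
  abel

theorem mul_self_mul_of_conj_eq_one {R : Type*} [Monoid R] {a b : R} (h : b * a * b = 1) :
    b * b * a = 1 := by
  have h' : b * a = a * b := by
    calc b * a = b * a * (b * a * b) := by rw [h, mul_one]
      _ = (b * a * b) * (a * b) := by simp only [mul_assoc]
      _ = a * b := by rw [h, one_mul]
  rw [mul_assoc, h', ← mul_assoc, h]

theorem isometry_of_conj_eq_one {κ ι : Type*} [Fintype κ] [Fintype ι] [DecidableEq ι]
    {D : Matrix κ ι A} {b : Matrix ι ι A} (hb : b.conjTranspose = b)
    (h : b * (D.conjTranspose * D) * b = 1) :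
    (D * b).conjTranspose * (D * b) = 1 := by
  rw [Matrix.conjTranspose_mul, hb, ← h]
  simp only [Matrix.mul_assoc]

section HarmonicProjection

variable {κ ι : Type*} [Fintype κ] [Fintype ι] [DecidableEq κ] [DecidableEq ι]
  {E N Y : Matrix κ κ A} {D : Matrix κ ι A} {b : Matrix ι ι A}

/-- The matrix Laplacian `N* N + D D*` vanishes on the complement of `E ⊕ range D`. -/
theorem laplacian_mul_complement (hE : IsStarProjection E) (hED : E * D = 0)
    (hb : b.conjTranspose = b) (h : b * (D.conjTranspose * D) * b = 1) (hNE : N * E = N) :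
    (N.conjTranspose * N + D * D.conjTranspose)
      * (1 - (E + (D * b) * (D * b).conjTranspose)) = 0 := by
  have hEE : E * E = E := hE.isIdempotentElem
  have hEs : E.conjTranspose = E := hE.isSelfAdjoint
  have hDE : D.conjTranspose * E = 0 := by
    simpa [hEs] using congrArg Matrix.conjTranspose hED
  have h1 : E * (1 - (E + (D * b) * (D * b).conjTranspose)) = 0 := by
    rw [mul_sub, mul_one, mul_add, hEE, ← Matrix.mul_assoc, ← Matrix.mul_assoc, hED]
    simp
  have h2 : D.conjTranspose * (1 - (E + (D * b) * (D * b).conjTranspose)) = 0 := by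
    have hab : D.conjTranspose * D * (b * b) = 1 := by
      have := congrArg Matrix.conjTranspose (mul_self_mul_of_conj_eq_one h)
      simpa [hb, Matrix.mul_assoc] using this
    have : D.conjTranspose * (D * b * (D * b).conjTranspose)
        = D.conjTranspose * D * (b * b) * D.conjTranspose := by
      rw [Matrix.conjTranspose_mul, hb]; simp only [Matrix.mul_assoc]
    rw [Matrix.mul_sub, Matrix.mul_one, Matrix.mul_add, hDE, this, hab]
    simp
  have h3 : N * (1 - (E + (D * b) * (D * b).conjTranspose)) = 0 := by
    rw [← hNE, Matrix.mul_assoc, h1, Matrix.mul_zero]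
  rw [Matrix.add_mul, Matrix.mul_assoc N.conjTranspose, h3, Matrix.mul_assoc D, h2]
  simp

/-- A left inverse of the matrix Laplacian `N* N + D D*` modulo its kernel: the restriction to
`range E` is inverted by `Y`, the restriction to the range of `D` through `(D* D)⁻¹ = b²`. -/
theorem inverse_mul_laplacian (hE : IsStarProjection E) (hED : E * D = 0)
    (hb : b.conjTranspose = b) (h : b * (D.conjTranspose * D) * b = 1) (hNE : N * E = N)
    (hN : N.conjTranspose = N) (hY : Y * N = E) :
    (Y * Y * E + D * (b * b) * (b * b) * D.conjTranspose)
        * (N.conjTranspose * N + D * D.conjTranspose)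
      = E + (D * b) * (D * b).conjTranspose := by
  have hEs : E.conjTranspose = E := hE.isSelfAdjoint
  have hEN : E * N = N := by
    simpa [hEs, hN] using congrArg Matrix.conjTranspose hNE
  have hDE : D.conjTranspose * E = 0 := by
    simpa [hEs] using congrArg Matrix.conjTranspose hED
  have hDN : D.conjTranspose * N = 0 := by
    rw [← hEN, ← Matrix.mul_assoc, hDE, Matrix.zero_mul]
  have hbba := mul_self_mul_of_conj_eq_one h
  have e1 : Y * Y * E * (N * N) = E := by
    calc Y * Y * E * (N * N) = Y * (Y * (E * N)) * N := by simp only [Matrix.mul_assoc]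
      _ = E := by rw [hEN, hY, Matrix.mul_assoc, hEN, hY]
  have e2 : Y * Y * E * (D * D.conjTranspose) = 0 := by
    rw [← Matrix.mul_assoc, Matrix.mul_assoc (Y * Y), hED]; simp
  have e3 : D * (b * b) * (b * b) * D.conjTranspose * (N * N) = 0 := by
    rw [← Matrix.mul_assoc, Matrix.mul_assoc _ D.conjTranspose N, hDN]; simp
  have e4 : D * (b * b) * (b * b) * D.conjTranspose * (D * D.conjTranspose)
      = D * b * (D * b).conjTranspose := by
    calc D * (b * b) * (b * b) * D.conjTranspose * (D * D.conjTranspose)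
        = D * (b * b) * (b * b * (D.conjTranspose * D)) * D.conjTranspose := by
          simp only [Matrix.mul_assoc]
      _ = D * b * (D * b).conjTranspose := by
          rw [hbba, Matrix.conjTranspose_mul, hb]; simp only [Matrix.mul_assoc, Matrix.one_mul]
  rw [hN, add_mul, mul_add, mul_add, e1, e2, e3, e4, add_zero, zero_add]

end HarmonicProjection

end Projections

/-- The inverse square root of a positive invertible element of a C*-algebra. -/
theorem exists_isSelfAdjoint_conj_eq_one {A : Type*} [CStarAlgebra A] (x y : A)
    (h : IsUnit (star x * x + star y * y)) :
    ∃ b : A, IsSelfAdjoint b ∧ b * (star x * x + star y * y) * b = 1 := by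
  let _ := CStarAlgebra.spectralOrder A
  have := CStarAlgebra.spectralOrderedRing A
  have h0 : 0 ≤ star x * x + star y * y :=
    add_nonneg (star_mul_self_nonneg x) (star_mul_self_nonneg y)
  exact ⟨_, .of_nonneg CFC.rpow_nonneg, CFC.conjugate_rpow_neg_one_half _ (h.isStrictlyPositive h0)⟩

/-! ### The spectral gap of the regular representation -/

noncomputable section SpectralGap

theorem memℓp_indicator {G : Type*} (S : Set G) {f : G → ℂ}
    (hf : Memℓp (E := fun _ : G => ℂ) f 2) : Memℓp (E := fun _ : G => ℂ) (S.indicator f) 2 := by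
  rw [memℓp_gen_iff (by norm_num)] at hf ⊢
  refine hf.of_nonneg_of_le (fun h => by positivity) fun h => ?_
  exact Real.rpow_le_rpow (norm_nonneg _) (norm_indicator_le_norm_self _ _) (by norm_num)

/-- The restriction of a square-summable function to a subset, extended by zero. -/
def ellTwoRestrict {G : Type*} (S : Set G) : EllTwo G →ₗ[ℂ] EllTwo G where
  toFun f := ⟨S.indicator f, memℓp_indicator S (lp.memℓp f)⟩
  map_add' f g := by ext h; exact congrFun (Set.indicator_add S f g) h
  map_smul' c f := by ext h; exact congrFun (Set.indicator_const_smul S c f) h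

theorem ellTwo_norm_sq {G : Type*} (f : EllTwo G) : ‖f‖ ^ 2 = ∑' h, ‖f h‖ ^ 2 := by
  simpa using lp.norm_rpow_eq_tsum (p := 2) (by norm_num) f

theorem ellTwo_summable_norm_sq {G : Type*} (f : EllTwo G) : Summable fun h => ‖f h‖ ^ 2 := by
  simpa using (memℓp_gen_iff (by norm_num)).mp (lp.memℓp f)

theorem ellTwoRestrict_apply {G : Type*} (S : Set G) (f : EllTwo G) (h : G) :
    ellTwoRestrict S f h = S.indicator f h := rfl

theorem norm_ellTwoRestrict_sq_add {G : Type*} {S T : Set G} (hST : Disjoint S T) (f : EllTwo G) :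
    ‖ellTwoRestrict S f‖ ^ 2 + ‖ellTwoRestrict T f‖ ^ 2 = ‖ellTwoRestrict (S ∪ T) f‖ ^ 2 := by
  simp only [ellTwo_norm_sq]
  rw [← (ellTwo_summable_norm_sq _).tsum_add (ellTwo_summable_norm_sq _)]
  refine tsum_congr fun h => ?_
  simp only [ellTwoRestrict_apply]
  by_cases h1 : h ∈ S
  · have h2 : h ∉ T := Set.disjoint_left.mp hST h1
    simp [h1, h2]
  · by_cases h2 : h ∈ T <;> simp [h1, h2]

theorem ellTwoRestrict_univ {G : Type*} (f : EllTwo G) : ellTwoRestrict Set.univ f = f := by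
  ext h; simp [ellTwoRestrict_apply]

theorem norm_ellTwoRestrict_le {G : Type*} (S : Set G) (f : EllTwo G) :
    ‖ellTwoRestrict S f‖ ≤ ‖f‖ := by
  have h := norm_ellTwoRestrict_sq_add (disjoint_compl_right (a := S)) f
  rw [Set.union_compl_self, ellTwoRestrict_univ] at h
  exact le_of_sq_le_sq (by nlinarith [sq_nonneg ‖ellTwoRestrict Sᶜ f‖]) (norm_nonneg _)

theorem norm_ellTwoRestrict_leftRegularRep {G : Type*} [Group G] (S : Set G) (g : G)
    (f : EllTwo G) :
    ‖ellTwoRestrict S (leftRegularRep G g f)‖ = ‖ellTwoRestrict ((g * ·) ⁻¹' S) f‖ := by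
  rw [← (leftRegularRep G g).norm_map (ellTwoRestrict ((g * ·) ⁻¹' S) f)]
  congr 1
  ext h
  change S.indicator (fun h => f (g⁻¹ * h)) h = ((g * ·) ⁻¹' S).indicator f (g⁻¹ * h)
  by_cases hS : h ∈ S <;> simp [hS]

theorem norm_ellTwoRestrict_le_translate {G : Type*} [Group G] (S : Set G) (g : G)
    (f : EllTwo G) :
    ‖ellTwoRestrict S f‖
      ≤ ‖ellTwoRestrict ((g * ·) ⁻¹' S) f‖ + ‖leftRegularRep G g f - f‖ := by
  rw [← norm_ellTwoRestrict_leftRegularRep]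
  have h := norm_ellTwoRestrict_le S (leftRegularRep G g f - f)
  rw [map_sub] at h
  have := norm_sub_norm_le (ellTwoRestrict S f) (ellTwoRestrict S (leftRegularRep G g f))
  rw [norm_sub_rev] at this
  linarith

/-- A spectral gap from a paradoxical set. A unit vector that `s` and `t` almost fix has almost
the same mass on all translates of a set. If `E`, `s⁻¹ E` are disjoint, and `F`, `t⁻¹ F`, `t⁻² F`
are, with `F` the complement of `E`, then `E` carries at most about `1/2` of the mass and `F` at
most about `1/3`, which do not add up to `1`. -/
theorem norm_le_of_paradoxical {G : Type*} [Group G] {s t : G} {E : Set G}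
    (hs : ∀ g ∈ E, s * g ∉ E) (ht : ∀ g, g ∉ E → t * g ∈ E) (ht2 : ∀ g, g ∉ E → t ^ 2 * g ∈ E)
    (f : EllTwo G) :
    ‖f‖ ≤ 6 * (‖leftRegularRep G s f - f‖ + 2 * ‖leftRegularRep G t f - f‖) := by
  have h1 := norm_ellTwoRestrict_sq_add (disjoint_compl_right (a := E)) f
  rw [Set.union_compl_self, ellTwoRestrict_univ] at h1
  have h2 := norm_ellTwoRestrict_sq_add (S := E) (T := (s * ·) ⁻¹' E)
    (Set.disjoint_left.mpr fun g hg => hs g hg) f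
  have h3 := norm_ellTwoRestrict_sq_add (S := Eᶜ) (T := (t * ·) ⁻¹' Eᶜ)
    (Set.disjoint_left.mpr fun g hg h => h (ht g hg)) f
  have h4 := norm_ellTwoRestrict_sq_add (S := Eᶜ ∪ (t * ·) ⁻¹' Eᶜ) (T := (t ^ 2 * ·) ⁻¹' Eᶜ)
    (Set.disjoint_left.mpr fun g hg h => by
      rcases hg with hg | hg
      · exact h (ht2 g hg)
      · apply h
        change t ^ 2 * g ∈ E
        rw [pow_two, mul_assoc]
        exact ht _ hg) f
  have h5 := norm_ellTwoRestrict_le (E ∪ (s * ·) ⁻¹' E) f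
  have h6 := norm_ellTwoRestrict_le (Eᶜ ∪ (t * ·) ⁻¹' Eᶜ ∪ (t ^ 2 * ·) ⁻¹' Eᶜ) f
  have h7 := norm_ellTwoRestrict_le_translate E s f
  have h8 := norm_ellTwoRestrict_le_translate Eᶜ t f
  have h9 := norm_ellTwoRestrict_le_translate Eᶜ (t ^ 2) f
  have h10 : ‖leftRegularRep G (t ^ 2) f - f‖ ≤ 2 * ‖leftRegularRep G t f - f‖ := by
    have e : leftRegularRep G (t ^ 2) f - f = leftRegularRep G t (leftRegularRep G t f - f)
        + (leftRegularRep G t f - f) := by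
      rw [pow_two, map_mul, map_sub]
      simp
    rw [e]
    refine (norm_add_le _ _).trans ?_
    rw [LinearIsometryEquiv.norm_map]
    linarith
  have h11 := norm_ellTwoRestrict_le E f
  have h12 := norm_ellTwoRestrict_le Eᶜ f
  -- `x² - 2 L d ≤ (x - d)² ≤ y²` if `d ≤ x`, and otherwise the left-hand side is at most `0`.
  have key : ∀ {x y d L : ℝ}, 0 ≤ y → 0 ≤ d → x ≤ L → x ≤ y + d → 0 ≤ x →
      x ^ 2 - 2 * L * d ≤ y ^ 2 := by
    intro x y d L hy hd hL h hx
    rcases le_total x d with hxd | hxd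
    · nlinarith [mul_nonneg hx (sub_nonneg.mpr hxd), mul_nonneg hd (sub_nonneg.mpr hL), sq_nonneg y]
    · nlinarith [pow_le_pow_left₀ (sub_nonneg.mpr hxd) (sub_le_iff_le_add.mpr h) 2,
        mul_nonneg hd (sub_nonneg.mpr hL), sq_nonneg d]
  have k1 := key (norm_nonneg _) (norm_nonneg _) h11 h7 (norm_nonneg _)
  have k2 := key (norm_nonneg _) (norm_nonneg _) h12 h8 (norm_nonneg _)
  have k3 := key (norm_nonneg _) (by positivity) h12 (h9.trans (add_le_add_right h10 _))
    (norm_nonneg _)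
  have h5' := pow_le_pow_left₀ (norm_nonneg _) h5 2
  have h6' := pow_le_pow_left₀ (norm_nonneg _) h6 2
  rcases (norm_nonneg f).eq_or_lt with h0 | h0
  · rw [← h0]; positivity
  · refine le_of_mul_le_mul_left ?_ h0
    nlinarith

open Monoid in
/-- The set of reduced words that begin with a letter from the second factor is paradoxical. -/
theorem exists_paradoxical {G : Bool → Type*} [∀ i, Group (G i)]
    {x : G true} {y : G false} (hx : x ≠ 1) (hy : y ≠ 1) (hy2 : y ^ 2 ≠ 1) :
    ∃ E : Set (Coprod (G true) (G false)),
      (∀ g ∈ E, Coprod.inl x * g ∉ E) ∧ (∀ g, g ∉ E → Coprod.inr y * g ∈ E) ∧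
        ∀ g, g ∉ E → Coprod.inr y ^ 2 * g ∈ E := by
  classical
  let φ : Coprod (G true) (G false) →* CoprodI G := Coprod.lift CoprodI.of CoprodI.of
  have fst : ∀ {i : Bool} {z : G i}, z ≠ 1 → ∀ w : CoprodI.Word G, w.fstIdx ≠ some i →
      (CoprodI.of z • w).fstIdx = some i := by
    intro i z hz w hw
    rw [← CoprodI.Word.cons_eq_smul (h1 := hw) (h2 := hz), CoprodI.Word.fstIdx_cons]
  refine ⟨{g | (φ g • (CoprodI.Word.empty : CoprodI.Word G)).fstIdx = some false}, ?_, ?_, ?_⟩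
  · intro g (hg : _ = _) (h : _ = _)
    rw [map_mul, mul_smul, Coprod.lift_apply_inl,
      fst hx _ (by rw [hg]; simp)] at h
    simp at h
  · intro g hg
    change _ = _
    rw [map_mul, mul_smul, Coprod.lift_apply_inr]
    exact fst hy _ hg
  · intro g hg
    change _ = _
    rw [map_mul, mul_smul, map_pow, Coprod.lift_apply_inr, ← map_pow]
    exact fst hy2 _ hg

/-- The trivial representation of `ℤ_m * ℤ_n` is isolated from the regular representation. -/
theorem CyclicFreeProduct.spectral_gap {m n : ℕ} {a : Multiplicative (ZMod m)}
    {b : Multiplicative (ZMod n)} (ha : a ≠ 1) (hb : b ≠ 1) (hb2 : b ^ 2 ≠ 1)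
    (f : EllTwo (CyclicFreeProduct m n)) :
    ‖f‖ ≤ 6 * (‖leftRegularRep (CyclicFreeProduct m n) (Monoid.Coprod.inl a) f - f‖
      + 2 * ‖leftRegularRep (CyclicFreeProduct m n) (Monoid.Coprod.inr b) f - f‖) := by
  obtain ⟨E, h1, h2, h3⟩ :=
    exists_paradoxical (G := fun i => Multiplicative (ZMod (cond i m n))) (x := a) (y := b) ha hb hb2
  exact norm_le_of_paradoxical h1 h2 h3 f

end SpectralGap

/-! ### Matrices of operators and averages in the reduced C*-algebra -/

section MatrixOperators

variable {H : Type*} [NormedAddCommGroup H] [InnerProductSpace ℂ H]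
  {ι κ τ : Type*} [Fintype ι] [Fintype κ] [Fintype τ]

theorem matrixOp_apply (T : Matrix κ ι (H →L[ℂ] H)) (x : PiLp 2 (fun _ : ι => H)) (i : κ) :
    matrixOp T x i = ∑ j, T i j (x j) := by
  simp [matrixOp]

theorem matrixOp_mul (S : Matrix τ κ (H →L[ℂ] H)) (T : Matrix κ ι (H →L[ℂ] H)) :
    matrixOp (S * T) = (matrixOp S).comp (matrixOp T) := by
  ext x i
  simp only [matrixOp_apply, ContinuousLinearMap.comp_apply, Matrix.mul_apply, map_sum,
    sum_apply, mul_apply_eq_comp]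
  exact Finset.sum_comm

theorem matrixOp_add (S T : Matrix κ ι (H →L[ℂ] H)) :
    matrixOp (S + T) = matrixOp S + matrixOp T := by
  ext x i
  simp [matrixOp_apply, Finset.sum_add_distrib]

theorem matrixOp_zero : matrixOp (0 : Matrix κ ι (H →L[ℂ] H)) = 0 := by
  ext x i
  simp [matrixOp_apply]

theorem matrixOp_one [DecidableEq ι] :
    matrixOp (1 : Matrix ι ι (H →L[ℂ] H)) = ContinuousLinearMap.id ℂ _ := by
  ext x i
  simp only [matrixOp_apply, Matrix.one_apply, ContinuousLinearMap.id_apply]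
  rw [Finset.sum_eq_single i (fun j _ h => by simp [h.symm]) (by simp)]
  simp

theorem adjoint_matrixOp [CompleteSpace H] (T : Matrix κ ι (H →L[ℂ] H)) :
    ContinuousLinearMap.adjoint (matrixOp T) = matrixOp T.conjTranspose := by
  symm
  rw [ContinuousLinearMap.eq_adjoint_iff]
  intro x y
  simp only [PiLp.inner_apply, matrixOp_apply, sum_inner, inner_sum, Matrix.conjTranspose_apply,
    ContinuousLinearMap.star_eq_adjoint, ContinuousLinearMap.adjoint_inner_left]
  exact Finset.sum_comm

/-- A matrix projection `P` that the Laplacian `L` kills, and modulo which `L` has a left inverse,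
is the orthogonal projection onto the kernel of the Laplacian. -/
theorem kazhdanProjection_eq_matrixOp [CompleteSpace H] {G : Type*} [Group G]
    (π : G →* (H ≃ₗᵢ[ℂ] H)) {D₀ : Matrix ι τ (MonoidAlgebra ℤ G)}
    {D₁ : Matrix κ ι (MonoidAlgebra ℤ G)} [DecidableEq ι] {P L X : Matrix ι ι (H →L[ℂ] H)}
    (hL : laplacian π D₀ D₁ = matrixOp L) (hP : IsStarProjection P) (hLP : L * P = 0)
    (hX : X * L = 1 - P) :
    kazhdanProjection π D₀ D₁ = matrixOp P := by
  have hPs : P.conjTranspose = P := hP.isSelfAdjoint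
  have hfix : ∀ w, matrixOp L w = 0 → matrixOp P w = w := by
    intro w hw
    have h : matrixOp (X * L + P) w = w := by
      rw [hX, sub_add_cancel, matrixOp_one, ContinuousLinearMap.id_apply]
    rwa [matrixOp_add, matrixOp_mul, add_apply,
      ContinuousLinearMap.comp_apply, hw, map_zero, zero_add] at h
  have hadj : ContinuousLinearMap.adjoint (matrixOp P) = matrixOp P := by
    rw [adjoint_matrixOp, hPs]
  have : CompleteSpace (laplacian π D₀ D₁).ker :=
    (laplacian π D₀ D₁).isClosed_ker.completeSpace_coe
  ext1 x
  refine Submodule.eq_starProjection_of_mem_of_inner_eq_zero ?_ fun w hw => ?_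
  · change laplacian π D₀ D₁ _ = 0
    rw [hL, ← ContinuousLinearMap.comp_apply, ← matrixOp_mul, hLP, matrixOp_zero,
      zero_apply]
  · change laplacian π D₀ D₁ w = 0 at hw
    rw [hL] at hw
    rw [← hfix w hw, ← hadj, ContinuousLinearMap.adjoint_inner_right, hadj, map_sub,
      ← ContinuousLinearMap.comp_apply, ← matrixOp_mul, hP.isIdempotentElem.eq, sub_self,
      inner_zero_left]

end MatrixOperators

section ReducedAlgebra

variable {G : Type*} [Group G]

theorem isClosed_redCStar : IsClosed (redCStar G : Set (EllTwo G →L[ℂ] EllTwo G)) :=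
  StarSubalgebra.isClosed_topologicalClosure _

theorem redCStar.of_one : redCStar.of (1 : G) = 1 :=
  Subtype.ext (map_one _)

theorem redCStar.of_mul (g h : G) : redCStar.of (g * h) = redCStar.of g * redCStar.of h :=
  Subtype.ext (map_mul _ _ _)

theorem redCStar.star_of_mul_of (g : G) : star (redCStar.of g) * redCStar.of g = 1 := by
  apply Subtype.ext
  change ContinuousLinearMap.adjoint (repOp (leftRegularRep G) g) ∘L repOp (leftRegularRep G) g
    = 1
  exact (ContinuousLinearMap.norm_map_iff_adjoint_comp_self _).mp
    fun x => (leftRegularRep G g).norm_map x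

theorem redCStar.of_mul_sum {m : ℕ} {g : G} (hg : g ^ m = 1) :
    redCStar.of g * ∑ i ∈ Finset.range m, redCStar.of (g ^ i)
      = ∑ i ∈ Finset.range m, redCStar.of (g ^ i) := by
  have h := Finset.sum_range_succ (fun i => redCStar.of (g ^ i)) m
  rw [Finset.sum_range_succ', hg, pow_zero] at h
  rw [Finset.mul_sum, ← add_right_cancel h]
  exact Finset.sum_congr rfl fun i _ => by rw [pow_succ', redCStar.of_mul]

theorem redCStar.of_mul_avg {m : ℕ} {g : G} (hg : g ^ m = 1) :
    redCStar.of g * redCStar.avg m g = redCStar.avg m g := by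
  rw [redCStar.avg, mul_smul_comm, redCStar.of_mul_sum hg]

theorem redCStar.of_pow_mul_avg {m : ℕ} {g : G} (hg : g ^ m = 1) (k : ℕ) :
    redCStar.of (g ^ k) * redCStar.avg m g = redCStar.avg m g := by
  induction k with
  | zero => rw [pow_zero, redCStar.of_one, one_mul]
  | succ k ih => rw [pow_succ, redCStar.of_mul, mul_assoc, redCStar.of_mul_avg hg, ih]

theorem redCStar.isStarProjection_avg {m : ℕ} (hm : m ≠ 0) {g : G} (hg : g ^ m = 1) :
    IsStarProjection (redCStar.avg m g) := by
  have hm' : (m : ℂ) ≠ 0 := Nat.cast_ne_zero.mpr hm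
  have h1 : ∀ k, star (redCStar.of (g ^ k)) * redCStar.avg m g = redCStar.avg m g := by
    intro k
    conv_lhs => rw [← redCStar.of_pow_mul_avg hg k]
    rw [← mul_assoc, redCStar.star_of_mul_of, one_mul]
  have h2 : star (redCStar.avg m g) * redCStar.avg m g = redCStar.avg m g := by
    conv_lhs => enter [1]; rw [redCStar.avg]
    rw [star_smul, star_sum, smul_mul_assoc, Finset.sum_mul, Finset.sum_congr rfl fun k _ => h1 k,
      Finset.sum_const, Finset.card_range, ← Nat.cast_smul_eq_nsmul ℂ, smul_smul]
    simp [hm']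
  have h3 : star (redCStar.avg m g) = redCStar.avg m g := by
    have h := congrArg star h2
    rw [star_mul, star_star, h2] at h
    exact h.symm
  exact ⟨by rw [h3] at h2; exact h2, h3⟩

theorem redCStar.avg_mul_of_sub_one {m : ℕ} (hm : m ≠ 0) {g : G} (hg : g ^ m = 1) :
    redCStar.avg m g * (redCStar.of g - 1) = 0 := by
  have h1 := (redCStar.isStarProjection_avg hm hg).isSelfAdjoint.star_eq
  have h : star (redCStar.of g) * redCStar.avg m g = redCStar.avg m g := by
    conv_lhs => rw [← redCStar.of_mul_avg hg]
    rw [← mul_assoc, redCStar.star_of_mul_of, one_mul]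
  have := congrArg star h
  rw [star_mul, star_star, h1] at this
  rw [mul_sub, this, mul_one, sub_self]

theorem isUnit_gram_redCStar {s t : G} {C : ℝ} (hC : 0 < C)
    (h : ∀ f : EllTwo G, ‖f‖ ≤ C * (‖leftRegularRep G s f - f‖ + 2 * ‖leftRegularRep G t f - f‖)) :
    IsUnit (star (redCStar.of s - 1) * (redCStar.of s - 1)
      + star (redCStar.of t - 1) * (redCStar.of t - 1)) := by
  have : IsClosed (redCStar G : Set (EllTwo G →L[ℂ] EllTwo G)) := isClosed_redCStar
  rw [← StarSubalgebra.coe_isUnit]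
  refine ContinuousLinearMap.isUnit_of_forall_le_norm_inner_map _
    (c := ⟨(5 * C ^ 2)⁻¹, by positivity⟩) (NNReal.coe_pos.mp (inv_pos.mpr (by positivity)))
    fun x => ?_
  set u := leftRegularRep G s x - x
  set v := leftRegularRep G t x - x
  have e : inner ℂ ((↑(star (redCStar.of s - 1) * (redCStar.of s - 1)
      + star (redCStar.of t - 1) * (redCStar.of t - 1)) : EllTwo G →L[ℂ] EllTwo G) x) x
      = ((‖u‖ ^ 2 + ‖v‖ ^ 2 : ℝ) : ℂ) := by
    change inner ℂ (ContinuousLinearMap.adjoint (repOp (leftRegularRep G) s - 1) u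
      + ContinuousLinearMap.adjoint (repOp (leftRegularRep G) t - 1) v) x = _
    rw [inner_add_left, ContinuousLinearMap.adjoint_inner_left,
      ContinuousLinearMap.adjoint_inner_left]
    change inner ℂ u u + inner ℂ v v = _
    rw [inner_self_eq_norm_sq_to_K, inner_self_eq_norm_sq_to_K]
    push_cast
    rfl
  rw [e, Complex.norm_real, Real.norm_of_nonneg (by positivity)]
  change ‖x‖ ^ 2 * (5 * C ^ 2)⁻¹ ≤ _
  rw [← div_eq_mul_inv, div_le_iff₀ (by positivity)]
  have h1 := pow_le_pow_left₀ (norm_nonneg _) (h x) 2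
  -- Cauchy-Schwarz: `(‖u‖ + 2 ‖v‖)² ≤ (1 + 2²) (‖u‖² + ‖v‖²)`
  have h2 : (‖u‖ + 2 * ‖v‖) ^ 2 ≤ 5 * (‖u‖ ^ 2 + ‖v‖ ^ 2) := by
    nlinarith [sq_nonneg (2 * ‖u‖ - ‖v‖)]
  calc ‖x‖ ^ 2 ≤ C ^ 2 * (‖u‖ + 2 * ‖v‖) ^ 2 := by rw [← mul_pow]; exact h1
    _ ≤ C ^ 2 * (5 * (‖u‖ ^ 2 + ‖v‖ ^ 2)) := by gcongr
    _ = _ := by ring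

theorem exists_conj_gram_redCStar (x y : redCStar G) (h : IsUnit (star x * x + star y * y)) :
    ∃ β : redCStar G, IsSelfAdjoint β ∧ β * (star x * x + star y * y) * β = 1 := by
  have : IsClosed (redCStar G : Set (EllTwo G →L[ℂ] EllTwo G)) := isClosed_redCStar
  exact exists_isSelfAdjoint_conj_eq_one x y h

end ReducedAlgebra

section FoxCalculus

variable {G : Type*} [Group G] {ι : Type*} [DecidableEq ι]

theorem GroupPres.foxWord_replicate (x : ι → G) (i j : ι) (m : ℕ) :
    GroupPres.foxWord x j (List.replicate m (i, true))
      = if i = j then ∑ k ∈ Finset.range m, MonoidAlgebra.of ℤ G (x i ^ k) else 0 := by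
  induction m with
  | zero => simp [GroupPres.foxWord]
  | succ m ih =>
    rw [List.replicate_succ, GroupPres.foxWord, ih]
    split_ifs
    · rw [Finset.sum_range_succ', Finset.mul_sum, pow_zero, map_one, add_comm]
      simp only [pow_succ', map_mul]
    · simp

theorem groupRingRep_of {H : Type*} [NormedAddCommGroup H] [InnerProductSpace ℂ H]
    (π : G →* (H ≃ₗᵢ[ℂ] H)) (g : G) : groupRingRep π (MonoidAlgebra.of ℤ G g) = repOp π g := by
  simp [groupRingRep]

theorem redCStar.coe_smul_avg {m : ℕ} (hm : m ≠ 0) (g : G) :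
    (((m : ℂ) • redCStar.avg m g : redCStar G) : EllTwo G →L[ℂ] EllTwo G)
      = groupRingRep (leftRegularRep G) (∑ k ∈ Finset.range m, MonoidAlgebra.of ℤ G (g ^ k)) := by
  rw [redCStar.avg, smul_smul, mul_inv_cancel₀ (Nat.cast_ne_zero.mpr hm), one_smul, map_sum,
    AddSubmonoidClass.coe_finsetSum]
  exact Finset.sum_congr rfl fun k _ => (groupRingRep_of _ _).symm

end FoxCalculus

/-! ### The Kazhdan projection of a free product of cyclic groups -/

theorem orderOf_generator {m : ℕ} {a : Multiplicative (ZMod m)}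
    (ha : ∀ x, x ∈ Subgroup.zpowers a) : orderOf a = m := by
  rw [orderOf_eq_card_of_forall_mem_zpowers ha, Nat.card_congr Multiplicative.toAdd, Nat.card_zmod]

theorem map_val_mul {G : Type*} [Group G] {ι κ τ : Type*} [Fintype κ]
    (S : Matrix ι κ (redCStar G)) (T : Matrix κ τ (redCStar G)) :
    (S * T).map Subtype.val
      = (S.map Subtype.val * T.map Subtype.val : Matrix ι τ (EllTwo G →L[ℂ] EllTwo G)) :=
  Matrix.map_mul (f := (redCStar G).subtype)

theorem map_val_conjTranspose {G : Type*} [Group G] {ι κ : Type*} (S : Matrix ι κ (redCStar G)) :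
    S.conjTranspose.map Subtype.val
      = ((S.map Subtype.val).conjTranspose : Matrix κ ι (EllTwo G →L[ℂ] EllTwo G)) := rfl

theorem laplacian_eq_matrixOp_map {G : Type*} [Group G] {α ι κ : Type*} [Fintype α] [Fintype ι]
    [Fintype κ] {D₀ : Matrix ι α (MonoidAlgebra ℤ G)} {D₁ : Matrix κ ι (MonoidAlgebra ℤ G)}
    {D : Matrix ι α (redCStar G)} {N : Matrix κ ι (redCStar G)}
    (hD : D₀.map (groupRingRep (leftRegularRep G)) = D.map Subtype.val)
    (hN : D₁.map (groupRingRep (leftRegularRep G)) = N.map Subtype.val) :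
    laplacian (leftRegularRep G) D₀ D₁
      = matrixOp ((N.conjTranspose * N + D * D.conjTranspose).map Subtype.val) := by
  have h : (N.conjTranspose * N + D * D.conjTranspose).map Subtype.val
      = (N.conjTranspose * N).map Subtype.val + (D * D.conjTranspose).map Subtype.val := rfl
  rw [laplacian, coboundary, coboundary, hD, hN, adjoint_matrixOp, adjoint_matrixOp,
    ← matrixOp_mul, ← matrixOp_mul, ← matrixOp_add, h, map_val_mul, map_val_mul]
  rfl

/-- The harmonic projection, computed in matrices over the reduced group C*-algebra. -/
theorem kazhdanProjection_eq_matrixOp_map {G : Type*} [Group G] {α ι κ : Type*} [Fintype α]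
    [Fintype ι] [Fintype κ] [DecidableEq ι] {D₀ : Matrix ι α (MonoidAlgebra ℤ G)}
    {D₁ : Matrix κ ι (MonoidAlgebra ℤ G)} {D : Matrix ι α (redCStar G)}
    {N : Matrix κ ι (redCStar G)} {P X : Matrix ι ι (redCStar G)}
    (hD : D₀.map (groupRingRep (leftRegularRep G)) = D.map Subtype.val)
    (hN : D₁.map (groupRingRep (leftRegularRep G)) = N.map Subtype.val)
    (hP : IsStarProjection P) (hLP : (N.conjTranspose * N + D * D.conjTranspose) * P = 0)
    (hXL : X * (N.conjTranspose * N + D * D.conjTranspose) = 1 - P) :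
    kazhdanProjection (leftRegularRep G) D₀ D₁ = matrixOp (P.map Subtype.val) := by
  refine kazhdanProjection_eq_matrixOp _ (laplacian_eq_matrixOp_map hD hN) ?_ ?_
    (X := X.map Subtype.val) ?_
  · constructor
    · rw [IsIdempotentElem, ← map_val_mul, hP.isIdempotentElem.eq]
    · change (Matrix.map _ _).conjTranspose = _
      rw [← map_val_conjTranspose]
      exact congrArg (fun M : Matrix _ _ _ => M.map Subtype.val) hP.isSelfAdjoint
  · rw [← map_val_mul, hLP]
    rfl
  · rw [← map_val_mul, hXL]
    ext1 i j
    by_cases h : i = j <;> simp [h]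

theorem redCStar.coe_of_sub_one {G : Type*} [Group G] (g : G) :
    ((redCStar.of g - 1 : redCStar G) : EllTwo G →L[ℂ] EllTwo G)
      = groupRingRep (leftRegularRep G) (MonoidAlgebra.of ℤ G g - 1) := by
  rw [map_sub, groupRingRep_of, map_one]
  rfl

theorem boundaryOne_map_leftRegularRep {G : Type*} [Group G] {ι ρ : Type*} [DecidableEq ι]
    (P : GroupPres G ι ρ) :
    P.boundaryOne.map (groupRingRep (leftRegularRep G))
      = (Matrix.of fun i (_ : Fin 1) => redCStar.of (P.gen i) - 1).map Subtype.val := by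
  ext1 i j
  exact (redCStar.coe_of_sub_one (P.gen i)).symm

/-- The Fox Jacobian of relators that are powers `x_i ^ k_i` of the generators is diagonal, with
entries `k_i` times the averages. -/
theorem boundaryTwo_map_leftRegularRep {G : Type*} [Group G] {ι : Type*} [DecidableEq ι]
    (P : GroupPres G ι ι) (k : ι → ℕ) (hk : ∀ i, k i ≠ 0)
    (hP : ∀ i, P.rel i = FreeGroup.of i ^ k i) :
    P.boundaryTwo.map (groupRingRep (leftRegularRep G))
      = (Matrix.diagonal fun i => (k i : ℂ) • redCStar.avg (k i) (P.gen i)).map Subtype.val := by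
  ext1 i j
  rw [Matrix.map_apply, Matrix.map_apply, GroupPres.boundaryTwo, Matrix.of_apply, hP,
    FreeGroup.toWord_of_pow, GroupPres.foxWord_replicate]
  by_cases h : i = j
  · subst h
    rw [if_pos rfl, Matrix.diagonal_apply_eq, redCStar.coe_smul_avg (hk i)]
  · rw [if_neg h, Matrix.diagonal_apply_ne _ h, map_zero]
    rfl

theorem blockSum_fin_one {A : Type*} [Ring A] (p q : A) :
    blockSum !![p] !![q] = Matrix.diagonal ![p, q] := by
  ext i j
  fin_cases i <;> fin_cases j <;> rfl

theorem isStarProjection_fin_one {A : Type*} [Ring A] [StarRing A] {p : A}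
    (hp : IsStarProjection p) : IsStarProjection !![p] := by
  refine ⟨?_, ?_⟩
  · ext i j
    fin_cases i; fin_cases j
    simpa [Matrix.mul_apply] using hp.isIdempotentElem.eq
  · ext i j
    fin_cases i; fin_cases j
    exact hp.isSelfAdjoint

/-- The harmonic projection of the matrix Laplacian `N* N + D D*`, where `N` is diagonal with entries
`c i • e i` and `D` is the column of elements `d i`, with `e i * d i = 0`, whose Gram element
`D* D` has the inverse square root `β`. -/
theorem exists_harmonic_projection {A : Type*} [Ring A] [StarRing A] [Algebra ℂ A] [StarModule ℂ A]
    {k : ℕ} {e : Fin k → A} {c : Fin k → ℕ} (hc : ∀ i, c i ≠ 0) (he : ∀ i, IsStarProjection (e i))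
    {d : Fin k → A} (hd : ∀ i, e i * d i = 0) {β : A} (hβ : IsSelfAdjoint β)
    (hβd : β * (∑ i, star (d i) * d i) * β = 1) (hE : IsStarProjection (Matrix.diagonal e)) :
    let N := Matrix.diagonal fun i => (c i : ℂ) • e i
    let D := Matrix.of fun i (_ : Fin 1) => d i
    ∃ (P X : Matrix (Fin k) (Fin k) A) (hP : IsStarProjection P),
      (N.conjTranspose * N + D * D.conjTranspose) * P = 0 ∧
      X * (N.conjTranspose * N + D * D.conjTranspose) = 1 - P ∧
      KZero.cls P hP = KZero.cls (1 : Matrix (Fin k) (Fin k) A) (IsStarProjection.one _)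
        - KZero.cls (Matrix.diagonal e) hE
        - KZero.cls (1 : Matrix (Fin 1) (Fin 1) A) (IsStarProjection.one _) := by
  intro N D
  set E := Matrix.diagonal e with hEdef
  let B : Matrix (Fin 1) (Fin 1) A := Matrix.diagonal fun _ => β
  have hED : E * D = 0 := by
    ext i j
    rw [hEdef, Matrix.diagonal_mul]
    exact hd i
  have hNE : N * E = N := by
    rw [hEdef, Matrix.diagonal_mul_diagonal]
    simp only [smul_mul_assoc, (he _).isIdempotentElem.eq]
    rfl
  have hN : N.conjTranspose = N := by
    rw [Matrix.diagonal_conjTranspose]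
    congr 1
    ext i
    simp [(he i).isSelfAdjoint.star_eq]
  have hY : (Matrix.diagonal fun i => (c i : ℂ)⁻¹ • (1 : A)) * N = E := by
    rw [Matrix.diagonal_mul_diagonal, hEdef]
    congr 1
    ext i
    simp [smul_smul, hc i]
  have hB : B.conjTranspose = B := by
    rw [Matrix.diagonal_conjTranspose]
    congr 1
    ext i
    exact hβ
  have hBD : B * (D.conjTranspose * D) * B = 1 := by
    ext i j
    rw [Matrix.mul_diagonal, Matrix.diagonal_mul, Subsingleton.elim i 0, Subsingleton.elim j 0]
    exact hβd
  have hV := isometry_of_conj_eq_one hB hBD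
  have hEV : E * (D * B) = 0 := by rw [← Matrix.mul_assoc, hED, Matrix.zero_mul]
  have hP := (isStarProjection_add_range hE hV hEV).one_sub
  exact ⟨_, _, hP, laplacian_mul_complement hE hED hB hBD hNE,
    (inverse_mul_laplacian hE hED hB hBD hNE hN hY).trans (sub_sub_cancel 1 _).symm,
    KZero.cls_one_sub hE hV hEV hP⟩

theorem theorem4 (m n : ℕ) (hm : 2 ≤ m) (hn : 3 ≤ n)
    (a : Multiplicative (ZMod m)) (ha : ∀ x, x ∈ Subgroup.zpowers a)
    (b : Multiplicative (ZMod n)) (hb : ∀ x, x ∈ Subgroup.zpowers b)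
    (s t : CyclicFreeProduct m n)
    (hs : s = Monoid.Coprod.inl a) (ht : t = Monoid.Coprod.inr b) :
    ∃ (P : Matrix (Fin 2) (Fin 2) (redCStar (CyclicFreeProduct m n)))
      (hP : IsStarProjection P)
      (hp : IsStarProjection !![redCStar.avg m s]) (hq : IsStarProjection !![redCStar.avg n t]),
      matrixOp (P.map Subtype.val) =
          (cyclicFreeProductPres m n a ha b hb).kazhdanOne
            (leftRegularRep (CyclicFreeProduct m n)) ∧
        KZero.cls P hP =
          KZero.cls (1 : Matrix (Fin 1) (Fin 1) (redCStar (CyclicFreeProduct m n)))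
              (IsStarProjection.one _) -
            KZero.cls !![redCStar.avg m s] hp - KZero.cls !![redCStar.avg n t] hq := by
  have oa := orderOf_generator ha
  have ob := orderOf_generator hb
  have hm0 : m ≠ 0 := by omega
  have hn0 : n ≠ 0 := by omega
  have ha1 : a ≠ 1 := fun h => by rw [h, orderOf_one] at oa; omega
  have hb1 : b ≠ 1 := fun h => by rw [h, orderOf_one] at ob; omega
  have hb2 : b ^ 2 ≠ 1 := fun h => by
    have := Nat.le_of_dvd two_pos (orderOf_dvd_of_pow_eq_one h)
    omega
  have hsm : s ^ m = 1 := by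
    rw [hs, ← map_pow, orderOf_dvd_iff_pow_eq_one.mp (dvd_of_eq oa), map_one]
  have htn : t ^ n = 1 := by
    rw [ht, ← map_pow, orderOf_dvd_iff_pow_eq_one.mp (dvd_of_eq ob), map_one]
  have hp' := redCStar.isStarProjection_avg hm0 hsm
  have hq' := redCStar.isStarProjection_avg hn0 htn
  have hp := isStarProjection_fin_one hp'
  have hq := isStarProjection_fin_one hq'
  obtain ⟨β, hβ, hβ1⟩ := exists_conj_gram_redCStar _ _ (isUnit_gram_redCStar (s := s) (t := t)
    (C := 6) (by norm_num) (by rw [hs, ht]; exact CyclicFreeProduct.spectral_gap ha1 hb1 hb2))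
  set pres := cyclicFreeProductPres m n a ha b hb with hpres
  have hg0 : pres.gen 0 = s := hs.symm
  have hg1 : pres.gen 1 = t := ht.symm
  have hk : ∀ i, ![m, n] i ≠ 0 := Fin.forall_fin_two.mpr ⟨hm0, hn0⟩
  have hdiag : (Matrix.diagonal fun i => redCStar.avg (![m, n] i) (pres.gen i))
      = blockSum !![redCStar.avg m s] !![redCStar.avg n t] := by
    rw [blockSum_fin_one]
    congr 1
    ext1 i
    revert i
    exact Fin.forall_fin_two.mpr
      ⟨congrArg (redCStar.avg m) hg0, congrArg (redCStar.avg n) hg1⟩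
  have hE : IsStarProjection (Matrix.diagonal fun i => redCStar.avg (![m, n] i) (pres.gen i)) := by
    rw [hdiag]
    exact isStarProjection_blockSum hp hq
  obtain ⟨P, X, hP, hLP, hXL, hcls⟩ := exists_harmonic_projection
    (e := fun i => redCStar.avg (![m, n] i) (pres.gen i)) (c := ![m, n])
    (d := fun i => redCStar.of (pres.gen i) - 1) hk
    (Fin.forall_fin_two.mpr ⟨by rw [hg0]; exact hp', by rw [hg1]; exact hq'⟩)
    (Fin.forall_fin_two.mpr
      ⟨by rw [hg0]; exact redCStar.avg_mul_of_sub_one hm0 hsm,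
        by rw [hg1]; exact redCStar.avg_mul_of_sub_one hn0 htn⟩)
    hβ (by rw [Fin.sum_univ_two, hg0, hg1]; exact hβ1) hE
  refine ⟨P, hP, hp, hq, ?_, ?_⟩
  · symm
    exact kazhdanProjection_eq_matrixOp_map (boundaryOne_map_leftRegularRep pres)
      (boundaryTwo_map_leftRegularRep pres ![m, n] hk
        (Fin.forall_fin_two.mpr ⟨rfl, rfl⟩)) hP hLP hXL
  · have h : KZero.cls _ hE
        = KZero.cls !![redCStar.avg m s] hp + KZero.cls !![redCStar.avg n t] hq := by
      rw [← KZero.cls_blockSum]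
      congr 1
    rw [hcls, h, KZero.cls_one_two]
    abel
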